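/- Consider first-order linear-time temporal logic over time $\mathbb{N}$ with predicate symbols of fixed arities (nullary ones are propositions), individual constants, no function symbols and no equality. Formulae are interpreted in temporal structures with a non-empty domain that is constant over time, rigid constants, and predicates whose interpretation may change at every moment; a formula is satisfiable if it is true at moment $0$ in some such structure under some assignment. A monodic temporal problem in divided separated normal form is a quadruple $\mathsf{P}=\langle \mathcal{U},\mathcal{I},\mathcal{S},\mathcal{E}\rangle$, where $\mathcal{U}$ (universal part) and $\mathcal{I}$ (initial part) are finite sets of closed first-order formulae without temporal operators; $\mathcal{S}$ (step part) is a finite set of step clauses, each either ground, $l\Rightarrow\bigcirc m$ with $l,m$ propositional literals, or non-ground, $L(x)\Rightarrow\bigcirc M(x)$ with $L,M$ unary literals; and $\mathcal{E}$ (eventuality part) is a finite set of eventuality clauses, each either ground, $\Diamond l$ with $l$ a propositional literal, or non-ground, $\Diamond L(x)$ with $L$ a unary literal. A problem is called satisfiable if its associated formula $$\mathcal{I}\wedge\Box\,\mathcal{U}\wedge\Box\,\forall x\,\mathcal{S}\wedge\Box\,\forall x\,\mathcal{E}$$ is satisfiable, where a finite set of formulae stands for its conjunction; the associated formula and satisfiability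 are defined in the same way if the eventuality part contains formulae of the form $\exists x\,\Diamond L(x)$ or $\Diamond L(c)$. Let $\mathrm{const}(\mathsf{P})$ be the set of constants occurring in $\mathsf{P}$. **Theorem (Reducing a Ground Next-time Problem).** Let $\mathsf{P}=\langle \mathcal{U},\mathcal{I},\mathcal{S},\mathcal{E}\rangle$ be a monodic temporal problem in divided separated normal form such that all step clauses in $\mathcal{S}$ are ground. Let $\mathcal{E}^{\exists}$ be obtained from $\mathcal{E}$ by replacing every non-ground eventuality clause $\Diamond L(x)$ by $\exists x\,\Diamond L(x)$ (and keeping the ground ones), and let $$\mathsf{P}'=\langle \mathcal{U},\mathcal{I},\mathcal{S},\ \mathcal{E}^{\exists}\cup\{\Diamond L(c) \mid \Diamond L(x)\in\mathcal{E},\ c\in\mathrm{const}(\mathsf{P})\}\rangle .$$ Then $\mathsf{P}$ is satisfiable if and only if $\mathsf{P}'$ is satisfiable. -/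

import Mathlib

universe u v w

namespace FOTL

/-- A signature of first-order temporal logic: individual constants and, for every arity `n`,
predicate symbols of arity `n` (those of arity `0` are the propositions).
There are no function symbols and no equality. -/
structure Signature where
  Const : Type u
  Pred : ℕ → Type v

/-- Terms: individual variables `x₀, x₁, …` and individual constants. -/
inductive Term (Sg : Signature.{u, v}) where
  | var (i : ℕ) : Term Sg
  | const (c : Sg.Const) : Term Sg

/-- Formulae of first-order linear time temporal logic. -/
inductive Formula (Sg : Signature.{u, v}) where
  | atom {n : ℕ} (p : Sg.Pred n) (ts : Fin n → Term Sg) : Formula Sg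
  | tru : Formula Sg
  | fls : Formula Sg
  | not (φ : Formula Sg) : Formula Sg
  | and (φ ψ : Formula Sg) : Formula Sg
  | or (φ ψ : Formula Sg) : Formula Sg
  | imp (φ ψ : Formula Sg) : Formula Sg
  | iff (φ ψ : Formula Sg) : Formula Sg
  | all (x : ℕ) (φ : Formula Sg) : Formula Sg
  | ex (x : ℕ) (φ : Formula Sg) : Formula Sg
  | next (φ : Formula Sg) : Formula Sg
  | always (φ : Formula Sg) : Formula Sg
  | eventually (φ : Formula Sg) : Formula Sg
  | strongUntil (φ ψ : Formula Sg) : Formula Sg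
  | weakUntil (φ ψ : Formula Sg) : Formula Sg

/-- A first-order temporal structure: a non-empty domain (the same at all moments of time), a rigid
interpretation of the constants, and for every moment an interpretation of the predicates. -/
structure TemporalStructure (Sg : Signature.{u, v}) where
  Dom : Type w
  nonempty : Nonempty Dom
  const : Sg.Const → Dom
  pred : ℕ → ∀ {n : ℕ}, Sg.Pred n → (Fin n → Dom) → Prop

namespace Term

variable {Sg : Signature.{u, v}}

/-- The value of a term under an assignment. -/
def eval (M : TemporalStructure.{u, v, w} Sg) (a : ℕ → M.Dom) : Term Sg → M.Dom
  | var i => a i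
  | const c => M.const c

/-- The variables of a term. -/
def vars : Term Sg → Set ℕ
  | var i => {i}
  | const _ => ∅

open Classical in
/-- The constants of a term. -/
noncomputable def consts : Term Sg → Finset Sg.Const
  | var _ => ∅
  | const c => {c}

end Term

namespace Formula

variable {Sg : Signature.{u, v}}

/-- The truth relation `M_n ⊨^a φ`. -/
def Holds (M : TemporalStructure.{u, v, w} Sg) : ℕ → (ℕ → M.Dom) → Formula Sg → Prop
  | n, a, atom p ts => M.pred n p (fun i => (ts i).eval M a)
  | _, _, tru => True
  | _, _, fls => False
  | n, a, not φ => ¬ Holds M n a φ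
  | n, a, and φ ψ => Holds M n a φ ∧ Holds M n a ψ
  | n, a, or φ ψ => Holds M n a φ ∨ Holds M n a ψ
  | n, a, imp φ ψ => Holds M n a φ → Holds M n a ψ
  | n, a, iff φ ψ => (Holds M n a φ ↔ Holds M n a ψ)
  | n, a, all x φ => ∀ d : M.Dom, Holds M n (Function.update a x d) φ
  | n, a, ex x φ => ∃ d : M.Dom, Holds M n (Function.update a x d) φ
  | n, a, next φ => Holds M (n + 1) a φ
  | n, a, always φ => ∀ m, n ≤ m → Holds M m a φ
  | n, a, eventually φ => ∃ m, n ≤ m ∧ Holds M m a φ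
  | n, a, strongUntil φ ψ =>
      ∃ m, n ≤ m ∧ Holds M m a ψ ∧ ∀ i, n ≤ i → i < m → Holds M i a φ
  | n, a, weakUntil φ ψ =>
      (∃ m, n ≤ m ∧ Holds M m a ψ ∧ ∀ i, n ≤ i → i < m → Holds M i a φ) ∨
        ∀ m, n ≤ m → Holds M m a φ

/-- A formula is satisfiable if it is true at moment `0` of some temporal structure under some
assignment. -/
def Satisfiable (φ : Formula Sg) : Prop :=
  ∃ (M : TemporalStructure.{u, v, w} Sg) (a : ℕ → M.Dom), Holds M 0 a φ

/-- The free variables of a formula. -/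
def freeVars : Formula Sg → Set ℕ
  | atom _ ts => ⋃ i, (ts i).vars
  | tru => ∅
  | fls => ∅
  | not φ => freeVars φ
  | and φ ψ => freeVars φ ∪ freeVars ψ
  | or φ ψ => freeVars φ ∪ freeVars ψ
  | imp φ ψ => freeVars φ ∪ freeVars ψ
  | iff φ ψ => freeVars φ ∪ freeVars ψ
  | all x φ => freeVars φ \ {x}
  | ex x φ => freeVars φ \ {x}
  | next φ => freeVars φ
  | always φ => freeVars φ
  | eventually φ => freeVars φ
  | strongUntil φ ψ => freeVars φ ∪ freeVars ψ
  | weakUntil φ ψ => freeVars φ ∪ freeVars ψ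

/-- A closed formula has no free variables. -/
def IsClosed (φ : Formula Sg) : Prop := freeVars φ = ∅

/-- A (classical) first-order formula contains no temporal operators. -/
def IsFirstOrder : Formula Sg → Prop
  | atom _ _ => True
  | tru => True
  | fls => True
  | not φ => IsFirstOrder φ
  | and φ ψ => IsFirstOrder φ ∧ IsFirstOrder ψ
  | or φ ψ => IsFirstOrder φ ∧ IsFirstOrder ψ
  | imp φ ψ => IsFirstOrder φ ∧ IsFirstOrder ψ
  | iff φ ψ => IsFirstOrder φ ∧ IsFirstOrder ψ
  | all _ φ => IsFirstOrder φ
  | ex _ φ => IsFirstOrder φ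
  | next _ => False
  | always _ => False
  | eventually _ => False
  | strongUntil _ _ => False
  | weakUntil _ _ => False

open Classical in
/-- `const(φ)`: the constants occurring in a formula. -/
noncomputable def consts : Formula Sg → Finset Sg.Const
  | atom _ ts => Finset.univ.biUnion fun i => (ts i).consts
  | tru => ∅
  | fls => ∅
  | not φ => consts φ
  | and φ ψ => consts φ ∪ consts ψ
  | or φ ψ => consts φ ∪ consts ψ
  | imp φ ψ => consts φ ∪ consts ψ
  | iff φ ψ => consts φ ∪ consts ψ
  | all _ φ => consts φ
  | ex _ φ => consts φ
  | next φ => consts φ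
  | always φ => consts φ
  | eventually φ => consts φ
  | strongUntil φ ψ => consts φ ∪ consts ψ
  | weakUntil φ ψ => consts φ ∪ consts ψ

/-- The conjunction of a finite set of formulae (in an arbitrary order). -/
noncomputable def conj (X : Finset (Formula Sg)) : Formula Sg :=
  X.toList.foldr and tru

end Formula

/-- A temporal problem: finite sets of formulae forming its universal, initial, step and
eventuality parts. The formulae of the last two parts may contain the variable `x = x₀`, over
which the associated formula quantifies universally. -/
structure TemporalProblem (Sg : Signature.{u, v}) where
  universal : Finset (Formula Sg)
  initial : Finset (Formula Sg)
  step : Finset (Formula Sg)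
  eventuality : Finset (Formula Sg)

namespace TemporalProblem

variable {Sg : Signature.{u, v}}

/-- The formula `I ∧ □U ∧ □∀x S ∧ □∀x E` associated with a temporal problem. -/
noncomputable def formula (P : TemporalProblem Sg) : Formula Sg :=
  (Formula.conj P.initial).and <|
    (Formula.conj P.universal).always.and <|
      (Formula.all 0 (Formula.conj P.step)).always.and
        (Formula.all 0 (Formula.conj P.eventuality)).always

/-- Satisfiability of a temporal problem is satisfiability of the associated formula. -/
def Satisfiable (P : TemporalProblem Sg) : Prop :=
  Formula.Satisfiable.{u, v, w} P.formula

/-- `const(P)`: the constants occurring in a temporal problem. -/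
noncomputable def consts (P : TemporalProblem Sg) : Finset Sg.Const :=
  P.formula.consts

end TemporalProblem

/-- Literals built from a predicate symbol of arity `n`: the symbol or its negation.
For `n = 0` these are the propositional literals, for `n = 1` the unary literals `L`. -/
inductive Literal (Sg : Signature.{u, v}) (n : ℕ) where
  | pos (p : Sg.Pred n) : Literal Sg n
  | neg (p : Sg.Pred n) : Literal Sg n

/-- The formula obtained by applying a literal to terms. -/
def Literal.app {Sg : Signature.{u, v}} {n : ℕ} : Literal Sg n → (Fin n → Term Sg) → Formula Sg
  | pos p, ts => Formula.atom p ts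
  | neg p, ts => (Formula.atom p ts).not

/-- A propositional literal as a formula. -/
def Literal.prop {Sg : Signature.{u, v}} (l : Literal Sg 0) : Formula Sg := l.app ![]

/-- `L(t)`, for a unary literal `L` and a term `t`. -/
def Literal.unary {Sg : Signature.{u, v}} (L : Literal Sg 1) (t : Term Sg) : Formula Sg :=
  L.app ![t]

/-- Temporal step clauses: ground ones `l ⇒ ○m` and non-ground ones `L(x) ⇒ ○M(x)`. -/
inductive StepClause (Sg : Signature.{u, v}) where
  | ground (l m : Literal Sg 0) : StepClause Sg
  | nonGround (L M : Literal Sg 1) : StepClause Sg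

/-- A step clause as a formula, where `x` is the variable `x₀`. -/
def StepClause.toFormula {Sg : Signature.{u, v}} : StepClause Sg → Formula Sg
  | ground l m => l.prop.imp m.prop.next
  | nonGround L M => (L.unary (.var 0)).imp (M.unary (.var 0)).next

/-- Being a ground step clause. -/
def StepClause.IsGround {Sg : Signature.{u, v}} : StepClause Sg → Prop
  | ground _ _ => True
  | nonGround _ _ => False

/-- Eventuality clauses: ground ones `◇l` and non-ground ones `◇L(x)`. -/
inductive EventualityClause (Sg : Signature.{u, v}) where
  | ground (l : Literal Sg 0) : EventualityClause Sg
  | nonGround (L : Literal Sg 1) : EventualityClause Sg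

namespace EventualityClause

variable {Sg : Signature.{u, v}}

/-- An eventuality clause as a formula, where `x` is the variable `x₀`. -/
def toFormula : EventualityClause Sg → Formula Sg
  | ground l => l.prop.eventually
  | nonGround L => (L.unary (.var 0)).eventually

/-- `◇L(x)` is replaced by `∃x ◇L(x)`; ground eventuality clauses are kept. -/
def existential : EventualityClause Sg → Formula Sg
  | ground l => (ground l).toFormula
  | nonGround L => Formula.ex 0 (nonGround L).toFormula

open Classical in
/-- The instances `◇L(c)`, `c ∈ C`, of a non-ground eventuality clause `◇L(x)`
(none for a ground clause). -/
noncomputable def instances (C : Finset Sg.Const) : EventualityClause Sg → Finset (Formula Sg)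
  | ground _ => ∅
  | nonGround L => C.image fun c => (L.unary (.const c)).eventually

end EventualityClause

/-- A monodic temporal problem in divided separated normal form. -/
structure DSNFProblem (Sg : Signature.{u, v}) where
  universal : Finset (Formula Sg)
  initial : Finset (Formula Sg)
  step : Finset (StepClause Sg)
  eventuality : Finset (EventualityClause Sg)
  universal_firstOrder : ∀ φ ∈ universal, φ.IsFirstOrder
  universal_closed : ∀ φ ∈ universal, φ.IsClosed
  initial_firstOrder : ∀ φ ∈ initial, φ.IsFirstOrder
  initial_closed : ∀ φ ∈ initial, φ.IsClosed

namespace DSNFProblem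

variable {Sg : Signature.{u, v}}

open Classical in
/-- The temporal problem given by the clauses of a problem in normal form. -/
noncomputable def toProblem (P : DSNFProblem Sg) : TemporalProblem Sg where
  universal := P.universal
  initial := P.initial
  step := P.step.image StepClause.toFormula
  eventuality := P.eventuality.image EventualityClause.toFormula

/-- A ground next-time problem: all step clauses are ground. -/
def IsGroundNextTime (P : DSNFProblem Sg) : Prop := ∀ s ∈ P.step, s.IsGround

open Classical in
/-- The problem `⟨U, I, S, E^∃ ∪ {◇L(c) | ◇L(x) ∈ E, c ∈ const(P)}⟩`, where `E^∃` arises from `E`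
by replacing every `◇L(x)` by `∃x ◇L(x)`. -/
noncomputable def existentialForm (P : DSNFProblem Sg) : TemporalProblem Sg where
  universal := P.universal
  initial := P.initial
  step := P.step.image StepClause.toFormula
  eventuality := P.eventuality.image EventualityClause.existential ∪
    P.eventuality.biUnion (EventualityClause.instances P.toProblem.consts)

end DSNFProblem

end FOTL

namespace FOTL

variable {Sg : Signature.{u, v}}

/-! Ground step clauses constrain only propositions, so nothing links the unary properties of an
individual at successive moments. Given a model `M` of the existential form, an individual may thus
be any sequence of elements of `M`, behaving at moment `n` like its `n`-th entry (`ofSequences`).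
The new domain `S` consists of the sequences that meet every `L` with `◇L(x)` in the problem
infinitely often.

Under `□`, `∃x ◇L(x)` supplies witnesses at arbitrarily late moments, and interleaving them gives an
element of `S` (`exists_seq_forall_frequently`); `◇L(c)` puts the constant sequence at `c` into `S`.
Changing one entry does not leave `S`, so evaluation at each moment maps `S` onto the domain of `M`.
Equality-free first-order formulae cannot distinguish the two sides of such a map
(`holds_pullback`), which preserves the initial and universal parts. -/

theorem Term.eval_congr (M : TemporalStructure.{u, v, w} Sg) {a b : ℕ → M.Dom} {t : Term Sg}
    (h : ∀ i ∈ t.vars, a i = b i) : t.eval M a = t.eval M b := by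
  cases t with
  | var i => exact h i rfl
  | const c => rfl

/-! ### Truth under changes of assignment and of domain -/

namespace Formula

theorem holds_conj (M : TemporalStructure.{u, v, w} Sg) (n : ℕ) (a : ℕ → M.Dom)
    (X : Finset (Formula Sg)) : Holds M n a (conj X) ↔ ∀ φ ∈ X, Holds M n a φ := by
  have key : ∀ l : List (Formula Sg),
      Holds M n a (l.foldr and tru) ↔ ∀ φ ∈ l, Holds M n a φ := by
    intro l
    induction l with
    | nil => simp [Holds]
    | cons φ l ih => simp [Holds, ih]
  simpa [conj] using key X.toList

theorem consts_subset_consts_conj {X : Finset (Formula Sg)} {φ : Formula Sg} (h : φ ∈ X) :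
    φ.consts ⊆ (conj X).consts := by
  have key : ∀ l : List (Formula Sg), φ ∈ l → φ.consts ⊆ (l.foldr and tru).consts := by
    intro l
    induction l with
    | nil => simp
    | cons ψ l ih =>
      intro hφ c hc
      rcases List.mem_cons.1 hφ with rfl | hφ
      · simp [consts, hc]
      · simp [consts, ih hφ hc]
  exact key X.toList (by simpa using h)

/-- The truth of a formula depends only on the values of its free variables. -/
theorem holds_congr (M : TemporalStructure.{u, v, w} Sg) (φ : Formula Sg) :
    ∀ (n : ℕ) (a b : ℕ → M.Dom), (∀ i ∈ φ.freeVars, a i = b i) →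
      (Holds M n a φ ↔ Holds M n b φ) := by
  have upd : ∀ (x : ℕ) (d : M.Dom) (s : Set ℕ) (a b : ℕ → M.Dom),
      (∀ i ∈ s \ {x}, a i = b i) →
        ∀ i ∈ s, Function.update a x d i = Function.update b x d i := by
    intro x d s a b h i hi
    by_cases hx : i = x
    · subst hx; simp
    · simpa [hx] using h i ⟨hi, hx⟩
  induction φ with
  | atom p ts =>
    intro n a b h
    have : (fun i => (ts i).eval M a) = fun i => (ts i).eval M b :=
      funext fun i => Term.eval_congr M fun j hj => h j (Set.mem_iUnion.2 ⟨i, hj⟩)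
    simp only [Holds, this]
  | tru => intros; rfl
  | fls => intros; rfl
  | not φ ih => intro n a b h; exact not_congr (ih n a b h)
  | and φ ψ ih₁ ih₂ =>
    intro n a b h
    exact and_congr (ih₁ n a b fun i hi => h i (.inl hi)) (ih₂ n a b fun i hi => h i (.inr hi))
  | or φ ψ ih₁ ih₂ =>
    intro n a b h
    exact or_congr (ih₁ n a b fun i hi => h i (.inl hi)) (ih₂ n a b fun i hi => h i (.inr hi))
  | imp φ ψ ih₁ ih₂ =>
    intro n a b h
    exact imp_congr (ih₁ n a b fun i hi => h i (.inl hi)) (ih₂ n a b fun i hi => h i (.inr hi))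
  | iff φ ψ ih₁ ih₂ =>
    intro n a b h
    exact iff_congr (ih₁ n a b fun i hi => h i (.inl hi)) (ih₂ n a b fun i hi => h i (.inr hi))
  | all x φ ih => intro n a b h; exact forall_congr' fun d => ih n _ _ (upd x d _ a b h)
  | ex x φ ih => intro n a b h; exact exists_congr fun d => ih n _ _ (upd x d _ a b h)
  | next φ ih => intro n a b h; exact ih (n + 1) a b h
  | always φ ih =>
    intro n a b h
    exact forall_congr' fun m => imp_congr Iff.rfl (ih m a b h)
  | eventually φ ih =>
    intro n a b h
    exact exists_congr fun m => and_congr Iff.rfl (ih m a b h)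
  | strongUntil φ ψ ih₁ ih₂ =>
    intro n a b h
    have h₁ := fun m => ih₁ m a b fun i hi => h i (.inl hi)
    have h₂ := fun m => ih₂ m a b fun i hi => h i (.inr hi)
    simp only [Holds, h₁, h₂]
  | weakUntil φ ψ ih₁ ih₂ =>
    intro n a b h
    have h₁ := fun m => ih₁ m a b fun i hi => h i (.inl hi)
    have h₂ := fun m => ih₂ m a b fun i hi => h i (.inr hi)
    simp only [Holds, h₁, h₂]

theorem IsClosed.holds_iff {φ : Formula Sg} (h : φ.IsClosed)
    (M : TemporalStructure.{u, v, w} Sg) (n : ℕ) (a b : ℕ → M.Dom) :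
    Holds M n a φ ↔ Holds M n b φ :=
  holds_congr M φ n a b fun i hi => by
    rw [show φ.freeVars = ∅ from h] at hi
    exact hi.elim

open Classical in
/-- First-order formulae without equality are preserved by surjections that respect the predicates
at the given moment and the constants occurring in the formula. -/
theorem holds_pullback (M N : TemporalStructure.{u, v, w} Sg) (n : ℕ) (f : N.Dom → M.Dom)
    (hf : Function.Surjective f)
    (hpred : ∀ {k : ℕ} (p : Sg.Pred k) (v : Fin k → N.Dom),
      N.pred n p v ↔ M.pred n p fun i => f (v i))
    (φ : Formula Sg) (hφ : φ.IsFirstOrder)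
    (hconst : ∀ c ∈ φ.consts, f (N.const c) = M.const c) (a : ℕ → N.Dom) :
    Holds N n a φ ↔ Holds M n (fun i => f (a i)) φ := by
  have upd : ∀ (a : ℕ → N.Dom) (x : ℕ) (d : N.Dom),
      (fun i => f (Function.update a x d i)) = Function.update (fun i => f (a i)) x (f d) := by
    intro a x d
    ext i
    by_cases hx : i = x
    · subst hx; simp
    · simp [hx]
  induction φ generalizing a with
  | atom p ts =>
    have : (fun i => f ((ts i).eval N a)) = fun i => (ts i).eval M fun j => f (a j) := by
      funext i
      cases h : ts i with
      | var j => rfl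
      | const c =>
        refine hconst c ?_
        simp only [consts, Finset.mem_biUnion, Finset.mem_univ, true_and]
        exact ⟨i, by simp [h, Term.consts]⟩
    simp only [Holds, hpred, this]
  | tru => rfl
  | fls => rfl
  | not φ ih => exact not_congr (ih hφ hconst a)
  | and φ ψ ih₁ ih₂ =>
    exact and_congr (ih₁ hφ.1 (fun c hc => hconst c (Finset.mem_union_left _ hc)) a)
      (ih₂ hφ.2 (fun c hc => hconst c (Finset.mem_union_right _ hc)) a)
  | or φ ψ ih₁ ih₂ =>
    exact or_congr (ih₁ hφ.1 (fun c hc => hconst c (Finset.mem_union_left _ hc)) a)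
      (ih₂ hφ.2 (fun c hc => hconst c (Finset.mem_union_right _ hc)) a)
  | imp φ ψ ih₁ ih₂ =>
    exact imp_congr (ih₁ hφ.1 (fun c hc => hconst c (Finset.mem_union_left _ hc)) a)
      (ih₂ hφ.2 (fun c hc => hconst c (Finset.mem_union_right _ hc)) a)
  | iff φ ψ ih₁ ih₂ =>
    exact iff_congr (ih₁ hφ.1 (fun c hc => hconst c (Finset.mem_union_left _ hc)) a)
      (ih₂ hφ.2 (fun c hc => hconst c (Finset.mem_union_right _ hc)) a)
  | all x φ ih =>
    have h := fun d => ih hφ hconst (Function.update a x d)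
    simp only [upd] at h
    simp only [Holds, h]
    -- By surjectivity, ranging over the values `f d` is ranging over all of `M`.
    exact (hf.forall (p := fun d => Holds M n (Function.update _ x d) φ)).symm
  | ex x φ ih =>
    have h := fun d => ih hφ hconst (Function.update a x d)
    simp only [upd] at h
    simp only [Holds, h]
    exact (hf.exists (p := fun d => Holds M n (Function.update _ x d) φ)).symm
  | next _ _ => exact hφ.elim
  | always _ _ => exact hφ.elim
  | eventually _ _ => exact hφ.elim
  | strongUntil _ _ _ _ => exact hφ.elim
  | weakUntil _ _ _ _ => exact hφ.elim

end Formula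

theorem TemporalProblem.holds_formula (P : TemporalProblem Sg)
    (M : TemporalStructure.{u, v, w} Sg) (a : ℕ → M.Dom) :
    Formula.Holds M 0 a P.formula ↔
      (∀ φ ∈ P.initial, Formula.Holds M 0 a φ) ∧
      (∀ n, ∀ φ ∈ P.universal, Formula.Holds M n a φ) ∧
      (∀ n d, ∀ φ ∈ P.step, Formula.Holds M n (Function.update a 0 d) φ) ∧
      ∀ n d, ∀ φ ∈ P.eventuality, Formula.Holds M n (Function.update a 0 d) φ := by
  simp [formula, Formula.Holds, Formula.holds_conj]

/-- A literal holds of a tuple of elements at a moment. -/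
def Literal.Sat {k : ℕ} (M : TemporalStructure.{u, v, w} Sg) (n : ℕ) (v : Fin k → M.Dom) :
    Literal Sg k → Prop
  | pos p => M.pred n p v
  | neg p => ¬ M.pred n p v

theorem Literal.holds_prop (M : TemporalStructure.{u, v, w} Sg) (n : ℕ) (a : ℕ → M.Dom)
    (l : Literal Sg 0) : Formula.Holds M n a l.prop ↔ l.Sat M n ![] := by
  cases l <;> simp [prop, app, Formula.Holds, Sat, Matrix.empty_eq]

theorem Literal.holds_unary (M : TemporalStructure.{u, v, w} Sg) (n : ℕ) (a : ℕ → M.Dom)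
    (L : Literal Sg 1) (t : Term Sg) :
    Formula.Holds M n a (L.unary t) ↔ L.Sat M n ![t.eval M a] := by
  have : (fun i => ((![t] : Fin 1 → Term Sg) i).eval M a) = ![t.eval M a] := by
    ext i
    fin_cases i
    rfl
  cases L <;> simp only [unary, app, Formula.Holds, Sat, this]

/-! ### Sequences as individuals -/

namespace TemporalStructure

/-- The structure whose elements are the sequences in `S`, where at moment `n` a sequence behaves
like its `n`-th entry. -/
def ofSequences (M : TemporalStructure.{u, v, w} Sg) (S : Set (ℕ → M.Dom)) (hS : S.Nonempty)
    (const : Sg.Const → S) : TemporalStructure.{u, v, w} Sg where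
  Dom := S
  nonempty := hS.to_subtype
  const := const
  pred n _ p v := M.pred n p fun i => (v i).1 n

variable (M : TemporalStructure.{u, v, w} Sg) (S : Set (ℕ → M.Dom)) (hS : S.Nonempty)
  (const : Sg.Const → S)

theorem sat_ofSequences {k : ℕ} (L : Literal Sg k) (n : ℕ) (v : Fin k → S) :
    L.Sat (M.ofSequences S hS const) n v ↔ L.Sat M n fun i => (v i).1 n := by
  cases L <;> rfl

theorem sat_ofSequences_zero (l : Literal Sg 0) (n : ℕ) :
    l.Sat (M.ofSequences S hS const) n ![] ↔ l.Sat M n ![] :=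
  (M.sat_ofSequences S hS const l n ![]).trans (by rw [Subsingleton.elim (fun i => _) ![]])

theorem sat_ofSequences_one (L : Literal Sg 1) (n : ℕ) (s : S) :
    L.Sat (M.ofSequences S hS const) n ![s] ↔ L.Sat M n ![s.1 n] := by
  refine (M.sat_ofSequences S hS const L n ![s]).trans ?_
  rw [show (fun i => ((![s] : Fin 1 → S) i).1 n) = ![s.1 n] by ext i; fin_cases i; rfl]

end TemporalStructure

/-- If each of countably many properties is infinitely often satisfiable, then a single sequence
satisfies all of them infinitely often. -/
theorem exists_seq_forall_frequently {ι : Type*} {D : Type*} [Countable ι] [Nonempty D]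
    (R : ι → ℕ → D → Prop) (h : ∀ i n, ∃ m, n ≤ m ∧ ∃ d, R i m d) :
    ∃ s : ℕ → D, ∀ i n, ∃ m, n ≤ m ∧ R i m (s m) := by
  rcases isEmpty_or_nonempty ι with _ | _
  · exact ⟨fun _ => Classical.arbitrary D, fun i => isEmptyElim i⟩
  obtain ⟨e, he⟩ := exists_surjective_nat ι
  -- Task `k` asks for property `e k.unpair.1`, so every property recurs infinitely often. As `g` is
  -- strictly increasing, tasks get distinct moments and one sequence can serve them all.
  obtain ⟨g, hg, hR⟩ := Filter.extraction_forall_of_frequently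
    (P := fun k m => ∃ d, R (e k.unpair.1) m d)
    fun k => Filter.frequently_atTop.2 fun n => h (e k.unpair.1) n
  choose d hd using hR
  refine ⟨Function.extend g d fun _ => Classical.arbitrary D, fun i n => ?_⟩
  obtain ⟨j, rfl⟩ := he i
  -- Late enough, since `n ≤ Nat.pair j n ≤ g (Nat.pair j n)`.
  refine ⟨g (Nat.pair j n), (Nat.right_le_pair j n).trans (hg.id_le _), ?_⟩
  rw [hg.injective.extend_apply]
  simpa using hd (Nat.pair j n)

/-! ### The two directions of the reduction -/

namespace DSNFProblem

variable (P : DSNFProblem Sg)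

open Classical in
theorem forall_mem_existentialForm_eventuality {p : Formula Sg → Prop} :
    (∀ φ ∈ P.existentialForm.eventuality, p φ) ↔
      (∀ l, .ground l ∈ P.eventuality → p l.prop.eventually) ∧
      ∀ L, .nonGround L ∈ P.eventuality →
        p (.ex 0 (L.unary (.var 0)).eventually) ∧
        ∀ c ∈ P.toProblem.consts, p (L.unary (.const c)).eventually := by
  simp only [existentialForm, Finset.mem_union, Finset.mem_image, Finset.mem_biUnion]
  constructor
  · intro h
    refine ⟨fun l hl => h _ (.inl ⟨_, hl, rfl⟩), fun L hL => ⟨h _ (.inl ⟨_, hL, rfl⟩), ?_⟩⟩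
    intro c hc
    exact h _ (.inr ⟨_, hL, Finset.mem_image_of_mem _ hc⟩)
  · rintro ⟨hl, hL⟩ φ (⟨e, he, rfl⟩ | ⟨e, he, hφ⟩)
    · cases e with
      | ground l => exact hl l he
      | nonGround L => exact (hL L he).1
    · cases e with
      | ground l => simp [EventualityClause.instances] at hφ
      | nonGround L =>
        obtain ⟨c, hc, rfl⟩ := Finset.mem_image.1 hφ
        exact (hL L he).2 c hc

open Classical in
theorem forall_mem_toProblem_eventuality {p : Formula Sg → Prop} :
    (∀ φ ∈ P.toProblem.eventuality, p φ) ↔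
      (∀ l, .ground l ∈ P.eventuality → p l.prop.eventually) ∧
      ∀ L, .nonGround L ∈ P.eventuality → p (L.unary (.var 0)).eventually := by
  simp only [toProblem, Finset.forall_mem_image]
  constructor
  · exact fun h => ⟨fun l hl => h hl, fun L hL => h hL⟩
  · rintro ⟨hl, hL⟩ (l | L) he
    · exact hl l he
    · exact hL L he

theorem consts_subset_of_mem_initial {φ : Formula Sg} (h : φ ∈ P.initial) :
    φ.consts ⊆ P.toProblem.consts := by
  intro c hc
  have := Formula.consts_subset_consts_conj h hc
  simp [TemporalProblem.consts, TemporalProblem.formula, Formula.consts, toProblem, this]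

theorem consts_subset_of_mem_universal {φ : Formula Sg} (h : φ ∈ P.universal) :
    φ.consts ⊆ P.toProblem.consts := by
  intro c hc
  have := Formula.consts_subset_consts_conj h hc
  simp [TemporalProblem.consts, TemporalProblem.formula, Formula.consts, toProblem, this]

/-- The same structure works: a universally quantified `◇L(x)` can be instantiated at any element,
in particular at the constants. -/
theorem satisfiable_existentialForm
    (h : TemporalProblem.Satisfiable.{u, v, w} P.toProblem) :
    TemporalProblem.Satisfiable.{u, v, w} P.existentialForm := by
  obtain ⟨M, a, h⟩ := h
  obtain ⟨hI, hU, hS, hE⟩ := (TemporalProblem.holds_formula _ M a).1 h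
  refine ⟨M, a, (TemporalProblem.holds_formula _ M a).2 ⟨hI, hU, hS, fun n d => ?_⟩⟩
  rw [forall_mem_existentialForm_eventuality]
  refine ⟨((P.forall_mem_toProblem_eventuality).1 (hE n d)).1, fun L hL => ⟨⟨d, ?_⟩, ?_⟩⟩
  · simpa using ((P.forall_mem_toProblem_eventuality).1 (hE n d)).2 L hL
  · intro c _
    obtain ⟨m, hm, hm'⟩ := ((P.forall_mem_toProblem_eventuality).1 (hE n (M.const c))).2 L hL
    refine ⟨m, hm, ?_⟩
    rw [Literal.holds_unary] at hm' ⊢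
    simpa [Term.eval] using hm'

open Classical in
theorem satisfiable_toProblem (hP : P.IsGroundNextTime)
    (h : TemporalProblem.Satisfiable.{u, v, w} P.existentialForm) :
    TemporalProblem.Satisfiable.{u, v, w} P.toProblem := by
  obtain ⟨M, a, h⟩ := h
  obtain ⟨hI, hU, hS, hE⟩ := (TemporalProblem.holds_formula _ M a).1 h
  have := M.nonempty
  -- The value `a 0` is immaterial: `x` is not free in these eventualities.
  have hE' := fun n => (P.forall_mem_existentialForm_eventuality).1 (hE n (a 0))
  let S : Set (ℕ → M.Dom) :=
    {s | ∀ L, .nonGround L ∈ P.eventuality → ∀ n, ∃ m, n ≤ m ∧ L.Sat M m ![s m]}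
  have hSne : S.Nonempty := by
    -- The literals are countable because they embed into the finite eventuality part.
    have inj : Function.Injective
        fun L : {L : Literal Sg 1 // .nonGround L ∈ P.eventuality} =>
          (⟨.nonGround L.1, L.2⟩ : P.eventuality) :=
      fun L L' hL => Subtype.ext (EventualityClause.nonGround.inj (congrArg Subtype.val hL))
    have := inj.countable
    obtain ⟨s, hs⟩ := exists_seq_forall_frequently
      (fun (L : {L : Literal Sg 1 // .nonGround L ∈ P.eventuality}) m d => L.1.Sat M m ![d]) <| by
        intro L n
        obtain ⟨d, m, hm, hd⟩ := ((hE' n).2 L.1 L.2).1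
        exact ⟨m, hm, _, (Literal.holds_unary ..).1 hd⟩
    exact ⟨s, fun L hL => hs ⟨L, hL⟩⟩
  have hSc : ∀ c ∈ P.toProblem.consts, (fun _ => M.const c) ∈ S := by
    intro c hc L hL n
    obtain ⟨m, hm, hd⟩ := ((hE' n).2 L hL).2 c hc
    exact ⟨m, hm, (Literal.holds_unary ..).1 hd⟩
  have hsurj : ∀ n, Function.Surjective fun s : S => s.1 n := by
    intro n d
    obtain ⟨s, hs⟩ := hSne
    refine ⟨⟨Function.update s n d, fun L hL k => ?_⟩, by simp⟩
    -- Beyond `n` the altered sequence agrees with `s`.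
    obtain ⟨m, hm, hd⟩ := hs L hL (max k (n + 1))
    refine ⟨m, by omega, ?_⟩
    rwa [Function.update_of_ne (by omega)]
  -- A constant foreign to the problem need not yield a constant sequence in `S`; it gets an
  -- arbitrary element, as no formula mentions it.
  let const : Sg.Const → S := fun c =>
    if hc : c ∈ P.toProblem.consts then ⟨_, hSc c hc⟩ else ⟨_, hSne.some_mem⟩
  have hconst : ∀ c ∈ P.toProblem.consts, ∀ n, (const c).1 n = M.const c := by
    intro c hc n
    simp [const, hc]
  let N := M.ofSequences S hSne const
  let b : ℕ → N.Dom := fun _ => ⟨_, hSne.some_mem⟩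
  have transfer : ∀ φ : Formula Sg, φ.IsFirstOrder → φ.IsClosed →
      φ.consts ⊆ P.toProblem.consts → ∀ n, Formula.Holds M n a φ → Formula.Holds N n b φ := by
    intro φ hfo hcl hc n hφ
    rw [Formula.holds_pullback M N n (fun s : S => s.1 n) (hsurj n) (fun _ _ => Iff.rfl) φ hfo
      (fun c hcφ => hconst c (hc hcφ) n)]
    -- The entries of `b` at moment `n` are unrelated to `a`; closedness makes this harmless.
    exact (hcl.holds_iff M n _ _).1 hφ
  refine ⟨N, b, (TemporalProblem.holds_formula _ N b).2 ⟨?_, ?_, ?_, ?_⟩⟩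
  · exact fun φ hφ => transfer φ (P.initial_firstOrder φ hφ) (P.initial_closed φ hφ)
      (P.consts_subset_of_mem_initial hφ) 0 (hI φ hφ)
  · exact fun n φ hφ => transfer φ (P.universal_firstOrder φ hφ) (P.universal_closed φ hφ)
      (P.consts_subset_of_mem_universal hφ) n (hU n φ hφ)
  · intro n d φ hφ
    obtain ⟨s, hs, rfl⟩ := Finset.mem_image.1 hφ
    have hM := hS n (a 0) _ hφ
    cases s with
    | ground l m =>
      simp only [StepClause.toFormula, Formula.Holds, Literal.holds_prop] at hM ⊢
      rwa [M.sat_ofSequences_zero, M.sat_ofSequences_zero]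
    -- Groundness is essential here: consecutive entries of a sequence in `S` are unrelated, so a
    -- non-ground step could fail.
    | nonGround L L' => exact (hP _ hs).elim
  · intro n d
    rw [forall_mem_toProblem_eventuality]
    constructor
    · intro l hl
      obtain ⟨m, hm, hlm⟩ := (hE' n).1 l hl
      refine ⟨m, hm, ?_⟩
      rw [Literal.holds_prop] at hlm ⊢
      rwa [M.sat_ofSequences_zero]
    · intro L hL
      obtain ⟨m, hm, hd⟩ := d.2 L hL n
      refine ⟨m, hm, ?_⟩
      rw [Literal.holds_unary]
      simp only [Term.eval, Function.update_self]
      exact (M.sat_ofSequences_one S hSne const L m d).2 hd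

end DSNFProblem

end FOTL

theorem mainTheorem9 (Sg : FOTL.Signature.{u, v}) (P : FOTL.DSNFProblem Sg)
    (hP : P.IsGroundNextTime) :
    FOTL.TemporalProblem.Satisfiable.{u, v, w} P.toProblem ↔
      FOTL.TemporalProblem.Satisfiable.{u, v, w} P.existentialForm :=
  ⟨P.satisfiable_existentialForm, P.satisfiable_toProblem hP⟩
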